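/- Let $M$ be a closed (compact, without boundary, Hausdorff) connected smooth manifold of dimension $n$, and let $g$ be a smooth pseudo-Riemannian metric on $M$ which is of indefinite signature (for no constant $c$ is the metric $c\cdot g$ Riemannian) and light-line-complete (every light-like geodesic, i.e. geodesic with nonzero velocity satisfying $g(\dot\gamma,\dot\gamma)=0$, extends to a geodesic defined for all values $t\in\mathbb{R}$ of its affine parameter). Let $(\hat M,\hat g)$ be the cone over $(M,g)$, that is, $\hat M=\mathbb{R}_{>0}\times M$ with the metric $\hat g=dr^2+r^2 g$, where $r$ is the standard coordinate on $\mathbb{R}_{>0}$. Then every smooth symmetric $(0,2)$-tensor field $\hat a$ on $\hat M$ which is parallel for the Levi-Civita connection $\hat\nabla$ of $\hat g$, i.e. $\hat\nabla_k\hat a_{ij}\equiv 0$, is a constant multiple of $\hat g$: there is $c\in\mathbb{R}$ with $\hat a=c\,\hat g$ on all of $\hat M$. -/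

import Mathlib

open Bundle Set Filter Topology
open scoped Manifold ContDiff

noncomputable section

namespace PseudoRiemannian

section Tensors

variable {E : Type*} [NormedAddCommGroup E] [NormedSpace ℝ E]
  {H : Type*} [TopologicalSpace H] (I : ModelWithCorners ℝ E H)
  (M : Type*) [TopologicalSpace M] [ChartedSpace H M]

/-- A (not necessarily smooth) `(0,2)`-tensor field on `M`: a bilinear form on every tangent
space. -/
abbrev TensorField02 : Type _ :=
  ∀ x : M, TangentSpace I x →L[ℝ] TangentSpace I x →L[ℝ] ℝ

variable {I M}

/-- The tensor field is symmetric, `B (v, w) = B (w, v)`. -/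
def IsSymmetric (B : TensorField02 I M) : Prop :=
  ∀ (x : M) (v w : TangentSpace I x), B x v w = B x w v

/-- The tensor field is a `C^∞` section of the bundle of bilinear forms on the tangent bundle. -/
def IsSmooth [IsManifold I ∞ M] (B : TensorField02 I M) : Prop :=
  ContMDiff I (I.prod 𝓘(ℝ, E →L[ℝ] E →L[ℝ] ℝ)) ∞
    (fun x ↦ TotalSpace.mk' (E →L[ℝ] E →L[ℝ] ℝ)
      (E := fun x : M ↦ TangentSpace I x →L[ℝ] TangentSpace I x →L[ℝ] ℝ) x (B x))

/-- A pseudo-Riemannian metric of arbitrary signature: a smooth symmetric `(0,2)`-tensor field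
which is nondegenerate at every point. -/
structure IsPseudoRiemannianMetric [IsManifold I ∞ M] (g : TensorField02 I M) : Prop where
  symm : IsSymmetric g
  smooth : IsSmooth g
  nondegenerate : ∀ (x : M) (v : TangentSpace I x), (∀ w : TangentSpace I x, g x v w = 0) → v = 0

/-- The metric is indefinite: for no constant `c` is the metric `c • g` Riemannian. -/
def IsIndefinite (g : TensorField02 I M) : Prop :=
  ¬ ∃ c : ℝ, ∀ (x : M) (v : TangentSpace I x), v ≠ 0 → 0 < c * g x v v

/-- The pullback `(u, v) ↦ B (L u) (L v)` of a bilinear form along a linear map. -/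
def pullbackForm {V W : Type*} [AddCommGroup V] [Module ℝ V] [TopologicalSpace V]
    [AddCommGroup W] [Module ℝ W] [TopologicalSpace W]
    (B : W →L[ℝ] W →L[ℝ] ℝ) (L : V →L[ℝ] W) : V →L[ℝ] V →L[ℝ] ℝ :=
  (ContinuousLinearMap.precomp ℝ L).comp (B.comp L)

@[simp] theorem pullbackForm_apply {V W : Type*} [AddCommGroup V] [Module ℝ V] [TopologicalSpace V]
    [AddCommGroup W] [Module ℝ W] [TopologicalSpace W]
    (B : W →L[ℝ] W →L[ℝ] ℝ) (L : V →L[ℝ] W) (u v : V) :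
    pullbackForm B L u v = B (L u) (L v) := rfl

/-- The components of a `(0,2)`-tensor field in the chart `e`: at the point `y` of the image of
the chart in the model space `E`, this is the pullback of `B` under the inverse of the chart,
`(u, v) ↦ ∑ B_{ij}(y) u^i v^j`. -/
def components (e : OpenPartialHomeomorph M H) (B : TensorField02 I M) (y : E) :
    E →L[ℝ] E →L[ℝ] ℝ :=
  pullbackForm (V := E) (B ((e.extend I).symm y)) (mfderiv 𝓘(ℝ, E) I (e.extend I).symm y)

end Tensors

section Coordinates

variable {E : Type*} [NormedAddCommGroup E] [NormedSpace ℝ E]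

/-- Christoffel symbols of the first kind of the matrix-valued function `G` at `y`:
`w ↦ (∂_u G(v, w) + ∂_v G(u, w) - ∂_w G(u, v)) / 2`. -/
def christoffelFirst (G : E → E →L[ℝ] E →L[ℝ] ℝ) (y u v : E) : E →L[ℝ] ℝ :=
  (1 / 2 : ℝ) • (fderiv ℝ G y u v + fderiv ℝ G y v u - ((fderiv ℝ G y).flip u).flip v)

/-- Christoffel symbols (of the second kind) of the Levi-Civita connection of `G` at `y`: the
vector with components `∑ Γ^i_{jk} u^j v^k`, obtained from the symbols of the first kind by raising
the index with the inverse of the nondegenerate form `G y`. -/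
def christoffel (G : E → E →L[ℝ] E →L[ℝ] ℝ) (y u v : E) : E :=
  (G y).inverse (christoffelFirst G y u v)

/-- Coordinate expression `(∇_u A) (v, w) = ∂_u A(v, w) - A(Γ(u, v), w) - A(v, Γ(u, w))` of the
covariant derivative, for the Levi-Civita connection of `G`, of the `(0,2)`-tensor `A`. -/
def covDeriv (G A : E → E →L[ℝ] E →L[ℝ] ℝ) (y u v w : E) : ℝ :=
  fderiv ℝ A y u v w - A y (christoffel G y u v) w - A y v (christoffel G y u w)

end Coordinates

section Geometry

variable {E : Type*} [NormedAddCommGroup E] [NormedSpace ℝ E]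
  {H : Type*} [TopologicalSpace H] {I : ModelWithCorners ℝ E H}
  {M : Type*} [TopologicalSpace M] [ChartedSpace H M]

/-- The `(0,2)`-tensor field `a` is parallel for the Levi-Civita connection of `g`: in every smooth
chart, all the components `∇_k a_{ij}` vanish. -/
def IsParallel (g a : TensorField02 I M) : Prop :=
  ∀ e ∈ IsManifold.maximalAtlas I ∞ M, ∀ y ∈ (e.extend I).target, ∀ u v w : E,
    covDeriv (components e g) (components e a) y u v w = 0

/-- `γ : ℝ → M` is an (affinely parametrised) geodesic of `g`: a smooth curve which in every smooth
chart satisfies `γ'' + Γ(γ', γ') = 0`. -/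
def IsGeodesic (g : TensorField02 I M) (γ : ℝ → M) : Prop :=
  ContMDiff 𝓘(ℝ, ℝ) I ∞ γ ∧
  ∀ e ∈ IsManifold.maximalAtlas I ∞ M, ∀ t : ℝ, γ t ∈ e.source →
    deriv (deriv (e.extend I ∘ γ)) t
      + christoffel (components e g) (e.extend I (γ t))
          (deriv (e.extend I ∘ γ) t) (deriv (e.extend I ∘ γ) t) = 0

/-- The metric is light-line-complete: every light-like tangent vector `v` (`v ≠ 0` and
`g (v, v) = 0`) is the initial velocity of a geodesic defined on the whole of `ℝ`, that is, every
light-like geodesic can be extended to all values of its affine parameter. -/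
def IsLightLineComplete (g : TensorField02 I M) : Prop :=
  ∀ (x : M) (v : TangentSpace I x), v ≠ 0 → g x v v = 0 →
    ∃ γ : ℝ → M, IsGeodesic g γ ∧
      (⟨γ 0, mfderiv 𝓘(ℝ, ℝ) I γ 0 (1 : ℝ)⟩ : TangentBundle I M) = ⟨x, v⟩

end Geometry

section Cone

variable {E : Type*} [NormedAddCommGroup E] [NormedSpace ℝ E]
  {H : Type*} [TopologicalSpace H] (I : ModelWithCorners ℝ E H)
  (M : Type*) [TopologicalSpace M] [ChartedSpace H M]

/-- The half-line `ℝ_{>0}`, an open submanifold of `ℝ`. -/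
abbrev PosReals : TopologicalSpace.Opens ℝ := ⟨Ioi 0, isOpen_Ioi⟩

/-- The manifold `ℝ_{>0} × M` underlying the cone over `M`, with its product manifold structure. -/
abbrev Cone : Type _ := PosReals × M

/-- The model with corners of the cone. -/
abbrev coneModel : ModelWithCorners ℝ (ℝ × E) (ModelProd ℝ H) := 𝓘(ℝ, ℝ).prod I

variable {I M}

/-- The differential `dr` at `p` of the coordinate `r : ℝ_{>0} × M → ℝ`. -/
def dRadius (p : Cone M) : TangentSpace (coneModel I) p →L[ℝ] ℝ :=
  mfderiv (coneModel I) 𝓘(ℝ, ℝ) (fun q : Cone M ↦ (q.1 : ℝ)) p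

/-- The cone metric `dr² + r² g` on `ℝ_{>0} × M` (where `g` is pulled back under the projection
to `M`). -/
def coneMetric (g : TensorField02 I M) : TensorField02 (coneModel I) (Cone M) :=
  fun p ↦ (dRadius p).smulRight (dRadius p)
    + (p.1 : ℝ) ^ 2 • pullbackForm (g p.2) (mfderiv (coneModel I) I (Prod.snd : Cone M → M) p)

end Cone

end PseudoRiemannian

end

noncomputable section

namespace PseudoRiemannian

section LinearAlgebra

variable {V : Type*} [AddCommGroup V] [Module ℝ V] [TopologicalSpace V]

/-- A bilinear form is indefinite if it takes both signs. -/
def TakesBothSigns (B : V →L[ℝ] V →L[ℝ] ℝ) : Prop :=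
  (∃ v, 0 < B v v) ∧ ∃ w, B w w < 0

/-- A linear functional which vanishes on the null cone of a symmetric bilinear form vanishes on
any two vectors of opposite signs. -/
theorem eq_zero_of_null_of_neg {B : V →L[ℝ] V →L[ℝ] ℝ} (hB : ∀ v w, B v w = B w v)
    {l : V →ₗ[ℝ] ℝ} (hl : ∀ v, B v v = 0 → l v = 0) {u w : V} (hu : 0 < B u u) (hw : B w w < 0) :
    l u = 0 ∧ l w = 0 := by
  have hD : 0 ≤ (B u w) ^ 2 - B u u * B w w := by nlinarith [sq_nonneg (B u w)]
  set s := √((B u w) ^ 2 - B u u * B w w) with hs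
  have hs2 : s ^ 2 = (B u w) ^ 2 - B u u * B w w := Real.sq_sqrt hD
  have hs0 : s ≠ 0 := by
    intro h
    rw [h] at hs2
    nlinarith [sq_nonneg (B u w)]
  have key : ∀ ε : ℝ, ε ^ 2 = 1 → B w w * l u + (-B u w + ε * s) * l w = 0 := by
    intro ε hε
    have h := hl (B w w • u + (-B u w + ε * s) • w) (by
      simp only [map_add, map_smul, add_apply, smul_apply,
        smul_eq_mul, hB w u]
      linear_combination B w w * s ^ 2 * hε + B w w * hs2)
    simpa using h
  have h1 := key 1 (by norm_num)
  have h2 := key (-1) (by norm_num)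
  have hlw : l w = 0 := by
    have : 2 * s * l w = 0 := by linear_combination h1 - h2
    simpa [hs0] using this
  refine ⟨?_, hlw⟩
  rw [hlw, mul_zero, add_zero] at h1
  exact (mul_eq_zero.1 h1).resolve_left hw.ne

/-- A linear functional which vanishes on the null cone of an indefinite symmetric bilinear form
is zero. -/
theorem TakesBothSigns.eq_zero_of_null {B : V →L[ℝ] V →L[ℝ] ℝ} (hB : ∀ v w, B v w = B w v)
    (hi : TakesBothSigns B) {l : V →ₗ[ℝ] ℝ} (hl : ∀ v, B v v = 0 → l v = 0) (u : V) : l u = 0 := by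
  obtain ⟨⟨v, hv⟩, w, hw⟩ := hi
  rcases lt_trichotomy (B u u) 0 with h | h | h
  · exact (eq_zero_of_null_of_neg hB hl hv h).2
  · exact hl u h
  · exact (eq_zero_of_null_of_neg hB hl h hw).1

/-- A nondegenerate symmetric form which does not take both signs is definite. -/
theorem definite_or_takesBothSigns {B : V →L[ℝ] V →L[ℝ] ℝ} (hB : ∀ v w, B v w = B w v)
    (hnd : ∀ v, (∀ w, B v w = 0) → v = 0) :
    (∀ v, v ≠ 0 → 0 < B v v) ∨ (∀ v, v ≠ 0 → B v v < 0) ∨ TakesBothSigns B := by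
  have null : ∀ v w, B v v = 0 → B v w ≠ 0 → TakesBothSigns B := by
    intro v w hv hvw
    have h : ∀ t : ℝ, B (t • v + B v w • w) (t • v + B v w • w)
        = (B v w) ^ 2 * (2 * t + B w w) := by
      intro t
      simp only [map_add, map_smul, add_apply, smul_apply,
        smul_eq_mul, hB w v, hv]
      ring
    have hp : 0 < (B v w) ^ 2 := by positivity
    refine ⟨⟨((1 - B w w) / 2) • v + B v w • w, ?_⟩, ((-1 - B w w) / 2) • v + B v w • w, ?_⟩ <;>
      rw [h] <;> nlinarith
  by_cases hi : TakesBothSigns B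
  · exact Or.inr (Or.inr hi)
  have hne : ∀ v, v ≠ 0 → B v v ≠ 0 := by
    intro v hv h
    obtain ⟨w, hw⟩ := not_forall.1 (mt (hnd v) hv)
    exact hi (null v w h hw)
  by_cases hp : ∃ v, 0 < B v v
  · refine Or.inl fun v hv ↦ lt_of_le_of_ne ?_ (hne v hv).symm
    by_contra! h
    exact hi ⟨hp, v, h⟩
  · push Not at hp
    exact Or.inr (Or.inl fun v hv ↦ lt_of_le_of_ne (hp v) (hne v hv))

end LinearAlgebra

section Coordinates

variable {E : Type*} [NormedAddCommGroup E] [NormedSpace ℝ E]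

theorem isInvertible_of_nondegenerate [FiniteDimensional ℝ E] {B : E →L[ℝ] E →L[ℝ] ℝ}
    (h : ∀ v, (∀ w, B v w = 0) → v = 0) : B.IsInvertible := by
  have hinj : Function.Injective (B : E →ₗ[ℝ] E →L[ℝ] ℝ) := by
    rw [injective_iff_map_eq_zero]
    exact fun v hv ↦ h v fun w ↦ by
      have := congrArg (fun f : E →L[ℝ] ℝ ↦ f w) hv
      simpa using this
  have hdim : Module.finrank ℝ E = Module.finrank ℝ (E →L[ℝ] ℝ) := by
    rw [← LinearEquiv.finrank_eq (LinearMap.toContinuousLinearMap (𝕜 := ℝ) (E := E) (F' := ℝ))]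
    exact (Subspace.dual_finrank_eq (K := ℝ) (V := E)).symm
  exact ⟨(LinearEquiv.ofInjectiveOfFinrankEq _ hinj hdim).toContinuousLinearEquiv, rfl⟩

variable {G A : E → E →L[ℝ] E →L[ℝ] ℝ} {y : E}

theorem christoffelFirst_apply (u v w : E) : christoffelFirst G y u v w =
    (1 / 2 : ℝ) * (fderiv ℝ G y u v w + fderiv ℝ G y v u w - fderiv ℝ G y w u v) := rfl

theorem apply_christoffel (hG : (G y).IsInvertible) (u v w : E) :
    G y (christoffel G y u v) w = christoffelFirst G y u v w := by
  rw [christoffel, hG.self_apply_inverse]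

theorem christoffel_eq (hG : (G y).IsInvertible) {u v z : E}
    (h : ∀ w, G y z w = christoffelFirst G y u v w) : christoffel G y u v = z :=
  (hG.inverse_apply_eq).2 (ContinuousLinearMap.ext fun w ↦ (h w).symm)

theorem fderiv_apply_apply (hA : DifferentiableAt ℝ A y) (u v w : E) :
    fderiv ℝ (fun z ↦ A z v w) y u = fderiv ℝ A y u v w := by
  have h := (hA.hasFDerivAt.clm_apply (hasFDerivAt_const v y)).clm_apply (hasFDerivAt_const w y)
  rw [h.fderiv]
  simp

theorem fderiv_symm (hA : DifferentiableAt ℝ A y) (hs : ∀ᶠ z in 𝓝 y, ∀ v w, A z v w = A z w v)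
    (u v w : E) : fderiv ℝ A y u v w = fderiv ℝ A y u w v := by
  rw [← fderiv_apply_apply hA, ← fderiv_apply_apply hA]
  have : (fun z ↦ A z v w) =ᶠ[𝓝 y] fun z ↦ A z w v := hs.mono fun z hz ↦ hz v w
  rw [this.fderiv_eq]

/-- The Levi-Civita connection is compatible with the metric. -/
theorem covDeriv_self (hG : (G y).IsInvertible) (hd : DifferentiableAt ℝ G y)
    (hs : ∀ᶠ z in 𝓝 y, ∀ v w, G z v w = G z w v) (u v w : E) : covDeriv G G y u v w = 0 := by
  rw [covDeriv, hs.self_of_nhds v, apply_christoffel hG, apply_christoffel hG,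
    christoffelFirst_apply, christoffelFirst_apply, fderiv_symm hd hs w u v, fderiv_symm hd hs u w v,
    fderiv_symm hd hs v u w]
  ring

/-- The product rule for the derivative of `A(X, Y)` along a curve `c`, in terms of covariant
derivatives. -/
theorem hasDerivAt_apply_apply {c X Y : ℝ → E} {c' X' Y' : E} {t : ℝ}
    (hA : DifferentiableAt ℝ A (c t)) (hc : HasDerivAt c c' t) (hX : HasDerivAt X X' t)
    (hY : HasDerivAt Y Y' t) :
    HasDerivAt (fun s ↦ A (c s) (X s) (Y s))
      (covDeriv G A (c t) c' (X t) (Y t) + A (c t) (X' + christoffel G (c t) c' (X t)) (Y t)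
        + A (c t) (X t) (Y' + christoffel G (c t) c' (Y t))) t := by
  have h1 : HasDerivAt (fun s ↦ A (c s)) (fderiv ℝ A (c t) c') t :=
    HasFDerivAt.comp_hasDerivAt (f := c) (l := A) t hA.hasFDerivAt hc
  have h2 : HasDerivAt (fun s ↦ A (c s) (X s)) (fderiv ℝ A (c t) c' (X t) + A (c t) X') t :=
    h1.clm_apply hX
  have h : HasDerivAt (fun s ↦ A (c s) (X s) (Y s))
      ((fderiv ℝ A (c t) c' (X t) + A (c t) X') (Y t) + A (c t) (X t) Y') t := h2.clm_apply hY
  refine h.congr_deriv ?_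
  simp only [covDeriv, map_add, add_apply]
  ring

theorem christoffel_smul_right (u : E) (k : ℝ) :
    christoffel G y u (k • u) = k • christoffel G y u u := by
  have : christoffelFirst G y u (k • u) = k • christoffelFirst G y u u := by
    refine ContinuousLinearMap.ext fun w ↦ ?_
    rw [smul_apply, christoffelFirst_apply, christoffelFirst_apply,
      ContinuousLinearMap.map_smul (fderiv ℝ G y u), ContinuousLinearMap.map_smul (fderiv ℝ G y),
      ContinuousLinearMap.map_smul (fderiv ℝ G y w u)]
    simp only [smul_apply, smul_eq_mul]
    ring
  rw [christoffel, this, map_smul, christoffel]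

theorem christoffel_zero_right (u : E) : christoffel G y u 0 = 0 := by
  simpa using christoffel_smul_right (G := G) (y := y) u 0

theorem _root_.Filter.EventuallyEq.christoffel_eq {G' : E → E →L[ℝ] E →L[ℝ] ℝ}
    (h : G =ᶠ[𝓝 y] G') (u v : E) : christoffel G y u v = christoffel G' y u v := by
  simp only [christoffel, christoffelFirst, h.fderiv_eq, h.self_of_nhds]

end Coordinates

section ConeCoordinates

variable {E : Type*} [NormedAddCommGroup E] [NormedSpace ℝ E]

theorem apply_prod_prod (B : (ℝ × E) →L[ℝ] (ℝ × E) →L[ℝ] ℝ) (u v : ℝ × E) :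
    B u v = u.1 * v.1 * B (1, 0) (1, 0) + u.1 * B (1, 0) (0, v.2) + v.1 * B (0, u.2) (1, 0)
      + B (0, u.2) (0, v.2) := by
  have h : ∀ w : ℝ × E, w = w.1 • ((1, 0) : ℝ × E) + (0, w.2) := fun w ↦ by simp
  conv_lhs => rw [h u, h v]
  simp only [map_add, map_smul, add_apply, smul_apply, smul_eq_mul]
  ring

/-- The cone metric `dr² + r² G` in coordinates. -/
def coneForm (G : E → E →L[ℝ] E →L[ℝ] ℝ) (p : ℝ × E) : (ℝ × E) →L[ℝ] (ℝ × E) →L[ℝ] ℝ :=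
  (ContinuousLinearMap.fst ℝ ℝ E).smulRight (ContinuousLinearMap.fst ℝ ℝ E)
    + p.1 ^ 2 • pullbackForm (G p.2) (ContinuousLinearMap.snd ℝ ℝ E)

variable {G : E → E →L[ℝ] E →L[ℝ] ℝ} {r : ℝ} {y : E}

theorem coneForm_apply (p u v : ℝ × E) :
    coneForm G p u v = u.1 * v.1 + p.1 ^ 2 * G p.2 u.2 v.2 := by
  simp [coneForm]

theorem _root_.ContDiffOn.coneForm [FiniteDimensional ℝ E] {s : Set E} {n : WithTop ℕ∞}
    (hG : ContDiffOn ℝ n G s) : ContDiffOn ℝ n (coneForm G) (univ ×ˢ s) := by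
  rw [contDiffOn_clm_apply]
  intro u
  rw [contDiffOn_clm_apply]
  intro v
  have h1 : ContDiffOn ℝ n (fun y ↦ G y u.2 v.2) s :=
    (hG.clm_apply contDiffOn_const).clm_apply contDiffOn_const
  have h2 : ContDiffOn ℝ n (fun q : ℝ × E ↦ G q.2 u.2 v.2) (univ ×ˢ s) :=
    h1.comp contDiffOn_snd fun q hq ↦ hq.2
  have h3 : ContDiffOn ℝ n (fun q : ℝ × E ↦ u.1 * v.1 + q.1 ^ 2 * G q.2 u.2 v.2) (univ ×ˢ s) :=
    contDiffOn_const.add ((contDiffOn_fst.pow 2).mul h2)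
  exact h3.congr fun q _ ↦ coneForm_apply q u v

theorem fderiv_coneForm (h : DifferentiableAt ℝ (coneForm G) (r, y)) (hG : DifferentiableAt ℝ G y)
    (u v w : ℝ × E) : fderiv ℝ (coneForm G) (r, y) u v w =
      2 * r * u.1 * G y v.2 w.2 + r ^ 2 * fderiv ℝ G y u.2 v.2 w.2 := by
  have hd : DifferentiableAt ℝ (fun z ↦ G z v.2 w.2) y :=
    (hG.clm_apply (differentiableAt_const v.2)).clm_apply (differentiableAt_const w.2)
  have h2 : HasFDerivAt (fun q : ℝ × E ↦ G q.2 v.2 w.2) _ (r, y) :=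
    HasFDerivAt.comp (g := fun z ↦ G z v.2 w.2) (f := fun q : ℝ × E ↦ q.2) (r, y) hd.hasFDerivAt
      (ContinuousLinearMap.snd ℝ ℝ E).hasFDerivAt
  have h1 : HasFDerivAt (fun q : ℝ × E ↦ q.1 ^ 2) _ (r, y) := (hasFDerivAt_fst (𝕜 := ℝ)).pow 2
  have h3 := (h1.mul h2).const_add (v.1 * w.1)
  have h4 : (fun q ↦ coneForm G q v w) = fun q ↦ v.1 * w.1 + q.1 ^ 2 * G q.2 v.2 w.2 :=
    funext fun q ↦ coneForm_apply q v w
  rw [← fderiv_apply_apply h, h4]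
  refine (congrArg (fun f : (ℝ × E) →L[ℝ] ℝ ↦ f u) h3.fderiv).trans ?_
  simp [fderiv_apply_apply hG]
  ring

/-- The Christoffel symbols of the cone metric. -/
theorem christoffel_coneForm (hr : r ≠ 0) (hi : (coneForm G (r, y)).IsInvertible)
    (hiG : (G y).IsInvertible)
    (h : DifferentiableAt ℝ (coneForm G) (r, y)) (hG : DifferentiableAt ℝ G y) (u v : ℝ × E) :
    christoffel (coneForm G) (r, y) u v =
      (-(r * G y u.2 v.2), christoffel G y u.2 v.2 + r⁻¹ • (u.1 • v.2 + v.1 • u.2)) := by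
  refine christoffel_eq hi fun w ↦ ?_
  rw [christoffelFirst_apply, fderiv_coneForm h hG, fderiv_coneForm h hG, fderiv_coneForm h hG,
    coneForm_apply]
  simp only [map_add, map_smul, add_apply, smul_apply,
    smul_eq_mul, apply_christoffel hiG, christoffelFirst_apply]
  field_simp
  ring

end ConeCoordinates

/-- A quadratic polynomial which is bounded on the real line has no linear term. -/
theorem linear_coeff_eq_zero_of_bounded {a b c C : ℝ}
    (h : ∀ t : ℝ, |a + b * t + c * t ^ 2| ≤ C) : b = 0 := by
  by_contra hb
  have h1 := abs_le.1 (h ((C + 1) / b))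
  have h2 := abs_le.1 (h (-((C + 1) / b)))
  have h3 : b * ((C + 1) / b) = C + 1 := by field_simp
  nlinarith

/-- If `f' = k f₁`, `f₁' = k' f₂`, `f₂' = 0` and `f` is bounded, then `f₁` vanishes at `0`. -/
theorem eq_zero_of_bounded_of_hasDerivAt {f f₁ f₂ : ℝ → ℝ} {k k' C : ℝ} (hk : k ≠ 0)
    (hf : ∀ t, HasDerivAt f (k * f₁ t) t) (hf₁ : ∀ t, HasDerivAt f₁ (k' * f₂ t) t)
    (hf₂ : ∀ t, HasDerivAt f₂ 0 t) (hC : ∀ t, |f t| ≤ C) : f₁ 0 = 0 := by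
  have e₂ : ∀ t, f₂ t = f₂ 0 := fun t ↦
    is_const_of_deriv_eq_zero (fun t ↦ (hf₂ t).differentiableAt) (fun t ↦ (hf₂ t).deriv) t 0
  have e₁ : ∀ t, f₁ t = f₁ 0 + k' * f₂ 0 * t := by
    intro t
    have hd : ∀ t, HasDerivAt (fun t ↦ f₁ t - k' * f₂ 0 * t) 0 t := fun t ↦
      ((hf₁ t).sub ((hasDerivAt_id t).const_mul (k' * f₂ 0))).congr_deriv (by rw [e₂ t]; ring)
    have := is_const_of_deriv_eq_zero (fun t ↦ (hd t).differentiableAt)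
      (fun t ↦ (hd t).deriv) t 0
    linarith
  have e : ∀ t, f t = f 0 + k * f₁ 0 * t + k * k' * f₂ 0 / 2 * t ^ 2 := by
    intro t
    have hd : ∀ t, HasDerivAt (fun t ↦ f t - (k * f₁ 0 * t + k * k' * f₂ 0 / 2 * t ^ 2)) 0 t :=
      fun t ↦ ((hf t).sub (((hasDerivAt_id t).const_mul (k * f₁ 0)).add
        (((hasDerivAt_id t).pow 2).const_mul (k * k' * f₂ 0 / 2)))).congr_deriv (by
          rw [e₁ t]; simp; ring)
    have := is_const_of_deriv_eq_zero (fun t ↦ (hd t).differentiableAt)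
      (fun t ↦ (hd t).deriv) t 0
    linarith
  have hlin := linear_coeff_eq_zero_of_bounded (fun t ↦ by rw [← e t]; exact hC t)
  exact (mul_eq_zero.1 hlin).resolve_left hk

section Components

variable {E : Type*} [NormedAddCommGroup E] [NormedSpace ℝ E]
  {H : Type*} [TopologicalSpace H] {I : ModelWithCorners ℝ E H}
  {M : Type*} [TopologicalSpace M] [ChartedSpace H M]

theorem components_chartAt_apply (B : TensorField02 I M) (x : M) (y u v : E) :
    components (chartAt H x) B y u v =
      B ((extChartAt I x).symm y) (mfderiv 𝓘(ℝ, E) I (extChartAt I x).symm y u)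
        (mfderiv 𝓘(ℝ, E) I (extChartAt I x).symm y v) := rfl

theorem IsSymmetric.components {B : TensorField02 I M} (hB : IsSymmetric B)
    (e : OpenPartialHomeomorph M H) (y u v : E) :
    components e B y u v = components e B y v u := hB _ _ _

variable [IsManifold I ∞ M] [I.Boundaryless]

theorem mfderiv_extChartAt_symm_self (x : M) :
    mfderiv 𝓘(ℝ, E) I (extChartAt I x).symm (extChartAt I x x) = ContinuousLinearMap.id ℝ E := by
  have : IsManifold I 1 M := IsManifold.of_le (n := ∞) (by simp)
  have := mfderivWithin_range_extChartAt_symm (I := I) (x := x)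
  rwa [I.range_eq_univ, mfderivWithin_univ] at this

theorem components_chartAt_self (B : TensorField02 I M) (x : M) (u v : E) :
    components (chartAt H x) B (extChartAt I x x) u v = B x u v := by
  have h := components_chartAt_apply B x (extChartAt I x x) u v
  rw [mfderiv_extChartAt_symm_self, extChartAt_to_inv] at h
  exact h

theorem mfderiv_extChartAt_symm_bijective (x : M) {y : E} (hy : y ∈ (extChartAt I x).target) :
    Function.Bijective (mfderiv 𝓘(ℝ, E) I (extChartAt I x).symm y) := by
  have : IsManifold I 1 M := IsManifold.of_le (n := ∞) (by simp)
  have := isInvertible_mfderivWithin_extChartAt_symm (I := I) hy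
  rw [I.range_eq_univ, mfderivWithin_univ] at this
  obtain ⟨e, he⟩ := this
  rw [← he]
  exact e.bijective

theorem nondegenerate_components {B : TensorField02 I M}
    (hB : ∀ (x : M) (v : TangentSpace I x), (∀ w : TangentSpace I x, B x v w = 0) → v = 0)
    (x : M) {y : E} (hy : y ∈ (extChartAt I x).target) (v : E)
    (hv : ∀ w, components (chartAt H x) B y v w = 0) : v = 0 := by
  have hb := mfderiv_extChartAt_symm_bijective (I := I) x hy
  refine (injective_iff_map_eq_zero _).1 hb.1 v (hB _ _ fun w ↦ ?_)
  obtain ⟨w, rfl⟩ := hb.2 w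
  exact hv w

theorem contMDiffOn_coordinateField (x : M) (u : E) :
    ContMDiffOn 𝓘(ℝ, E) I.tangent ∞ (fun y ↦ (⟨(extChartAt I x).symm y,
      mfderiv 𝓘(ℝ, E) I (extChartAt I x).symm y u⟩ : TangentBundle I M))
      (extChartAt I x).target := by
  have ho := isOpen_extChartAt_target (I := I) x
  have h1 := (contMDiffOn_extChartAt_symm (I := I) (n := ∞) x).contMDiffOn_tangentMapWithin
    (m := ∞) (by simp) ho.uniqueMDiffOn
  have h2 : ContMDiff 𝓘(ℝ, E) (𝓘(ℝ, E).tangent) ∞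
      (fun y : E ↦ (⟨y, u⟩ : TangentBundle 𝓘(ℝ, E) E)) :=
    contMDiff_vectorSpace_iff_contDiff.2 contDiff_const
  refine (h1.comp h2.contMDiffOn fun y hy ↦ hy).congr fun y hy ↦ ?_
  simp only [Function.comp, tangentMapWithin]
  rw [mfderivWithin_of_isOpen ho hy]

theorem IsSmooth.contDiffOn_components [FiniteDimensional ℝ E] {B : TensorField02 I M}
    (hB : IsSmooth B) (x : M) :
    ContDiffOn ℝ ∞ (components (chartAt H x) B) (extChartAt I x).target := by
  rw [contDiffOn_clm_apply]
  intro u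
  rw [contDiffOn_clm_apply]
  intro v
  have h := ((hB.comp_contMDiffOn (contMDiffOn_extChartAt_symm (I := I) x)).clm_bundle_apply
    (contMDiffOn_coordinateField x u)).clm_bundle_apply (E₂ := Bundle.Trivial M ℝ)
    (contMDiffOn_coordinateField x v)
  intro y hy
  have h' := (contMDiffWithinAt_totalSpace.1 (h y hy)).2
  exact h'.contDiffWithinAt

theorem IsSmooth.differentiableAt_components [FiniteDimensional ℝ E] {B : TensorField02 I M}
    (hB : IsSmooth B) (x : M) {y : E} (hy : y ∈ (extChartAt I x).target) :
    DifferentiableAt ℝ (components (chartAt H x) B) y :=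
  ((hB.contDiffOn_components x).contDiffAt
    ((isOpen_extChartAt_target x).mem_nhds hy)).differentiableAt (by simp)

theorem isInvertible_components [FiniteDimensional ℝ E] {B : TensorField02 I M}
    (hB : IsPseudoRiemannianMetric B) (x : M) {y : E} (hy : y ∈ (extChartAt I x).target) :
    (components (chartAt H x) B y).IsInvertible :=
  isInvertible_of_nondegenerate (nondegenerate_components hB.nondegenerate x hy)

end Components

section Curves

variable {E : Type*} [NormedAddCommGroup E] [NormedSpace ℝ E]
  {H : Type*} [TopologicalSpace H] {I : ModelWithCorners ℝ E H}
  {M : Type*} [TopologicalSpace M] [ChartedSpace H M]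

/-- The velocity of a curve. -/
def velocity (I : ModelWithCorners ℝ E H) (γ : ℝ → M) (t : ℝ) : TangentSpace I (γ t) :=
  mfderiv 𝓘(ℝ, ℝ) I γ t (1 : ℝ)

theorem tangentBundle_mk_eq {x y : M} {v w : E} (hx : x = y) (hv : v = w) :
    (⟨x, v⟩ : TangentBundle I M) = ⟨y, w⟩ := by
  subst hx hv
  rfl

variable [IsManifold I ∞ M] [I.Boundaryless] {γ : ℝ → M}

omit [I.Boundaryless] in
theorem contDiffAt_extChartAt_comp (hγ : ContMDiff 𝓘(ℝ, ℝ) I ∞ γ) (x : M) {t : ℝ}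
    (ht : γ t ∈ (extChartAt I x).source) : ContDiffAt ℝ ∞ (extChartAt I x ∘ γ) t := by
  rw [extChartAt_source] at ht
  exact ((contMDiffAt_extChartAt' ht).comp t (hγ t)).contDiffAt

theorem mfderiv_extChartAt_symm_deriv (hγ : ContMDiff 𝓘(ℝ, ℝ) I ∞ γ) (x : M) {t : ℝ}
    (ht : γ t ∈ (extChartAt I x).source) :
    (⟨(extChartAt I x).symm (extChartAt I x (γ t)), mfderiv 𝓘(ℝ, E) I (extChartAt I x).symm
      (extChartAt I x (γ t)) (deriv (extChartAt I x ∘ γ) t)⟩ : TangentBundle I M) =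
      ⟨γ t, velocity I γ t⟩ := by
  have hc := contDiffAt_extChartAt_comp hγ x ht
  have hev : γ =ᶠ[𝓝 t] (extChartAt I x).symm ∘ (extChartAt I x ∘ γ) := by
    filter_upwards [hγ.continuous.continuousAt.preimage_mem_nhds
      ((isOpen_extChartAt_source x).mem_nhds ht)] with s hs
    exact ((extChartAt I x).left_inv hs).symm
  have hmd : MDifferentiableAt 𝓘(ℝ, E) I (extChartAt I x).symm ((extChartAt I x ∘ γ) t) :=
    (contMDiffOn_extChartAt_symm (I := I) (n := ∞) x).contMDiffAt
      ((isOpen_extChartAt_target x).mem_nhds ((extChartAt I x).map_source ht))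
      |>.mdifferentiableAt (by simp)
  have h := mfderiv_comp t hmd (hc.differentiableAt (by simp)).mdifferentiableAt
  have hγt : mfderiv 𝓘(ℝ, ℝ) I γ t = mfderiv 𝓘(ℝ, ℝ) I
      ((extChartAt I x).symm ∘ (extChartAt I x ∘ γ)) t := hev.mfderiv_eq
  refine tangentBundle_mk_eq ((extChartAt I x).left_inv ht) ?_
  refine Eq.trans ?_ (congrArg (fun L : ℝ →L[ℝ] E ↦ L 1) (hγt.trans h)).symm
  rw [mfderiv_eq_fderiv]
  rfl

end Curves

section Cone

variable {E : Type*} [NormedAddCommGroup E] [NormedSpace ℝ E]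
  {H : Type*} [TopologicalSpace H] {I : ModelWithCorners ℝ E H}
  {M : Type*} [TopologicalSpace M] [ChartedSpace H M]

theorem extChartAt_posReals (q q' : PosReals) : extChartAt 𝓘(ℝ, ℝ) q = extChartAt 𝓘(ℝ, ℝ) q' := rfl

theorem extChartAt_posReals_apply (q q' : PosReals) : extChartAt 𝓘(ℝ, ℝ) q q' = q' := rfl

theorem extChartAt_posReals_target (q : PosReals) : (extChartAt 𝓘(ℝ, ℝ) q).target = Ioi 0 := by
  rw [extChartAt_target, TopologicalSpace.Opens.chartAt_eq]
  simp only [OpenPartialHomeomorph.subtypeRestr, chartAt_self_eq]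
  simp

theorem extChartAt_posReals_symm (q q' : PosReals) : (extChartAt 𝓘(ℝ, ℝ) q).symm q' = q' := by
  rw [← extChartAt_posReals_apply q' q', extChartAt_posReals q q', extChartAt_to_inv]

end Cone

section Cone

variable {E : Type*} [NormedAddCommGroup E] [NormedSpace ℝ E]
  {H : Type*} [TopologicalSpace H] {I : ModelWithCorners ℝ E H}
  {M : Type*} [TopologicalSpace M] [ChartedSpace H M]

theorem extChartAt_cone_apply (p q : Cone M) :
    extChartAt (coneModel I) p q = ((q.1 : ℝ), extChartAt I p.2 q.2) := by
  rw [extChartAt_prod]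
  rfl

theorem extChartAt_cone_target (p : Cone M) :
    (extChartAt (coneModel I) p).target = Ioi 0 ×ˢ (extChartAt I p.2).target := by
  rw [extChartAt_prod, PartialEquiv.prod_target, extChartAt_posReals_target]

theorem extChartAt_cone_symm_apply (p : Cone M) (r : PosReals) (y : E) :
    (extChartAt (coneModel I) p).symm ((r : ℝ), y) = (r, (extChartAt I p.2).symm y) := by
  rw [extChartAt_prod]
  exact Prod.ext (extChartAt_posReals_symm _ _) rfl

theorem hasMFDerivAt_extChartAt_posReals_symm (q r : PosReals) :
    HasMFDerivAt 𝓘(ℝ, ℝ) 𝓘(ℝ, ℝ) (extChartAt 𝓘(ℝ, ℝ) q).symm (r : ℝ)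
      (ContinuousLinearMap.id ℝ ℝ) := by
  have ht : (r : ℝ) ∈ (extChartAt 𝓘(ℝ, ℝ) r).target := by
    rw [extChartAt_posReals_target]
    exact r.2
  have hmd : MDifferentiableAt 𝓘(ℝ, ℝ) 𝓘(ℝ, ℝ) (extChartAt 𝓘(ℝ, ℝ) r).symm (r : ℝ) :=
    (contMDiffOn_extChartAt_symm (I := 𝓘(ℝ, ℝ)) (n := ∞) r).contMDiffAt
      ((isOpen_extChartAt_target r).mem_nhds ht) |>.mdifferentiableAt (by simp)
  have h := hmd.hasMFDerivAt
  have h' := mfderiv_extChartAt_symm_self (I := 𝓘(ℝ, ℝ)) r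
  rw [extChartAt_posReals_apply] at h'
  rwa [h'] at h

theorem mfderiv_posReals_coe (r : PosReals) :
    mfderiv 𝓘(ℝ, ℝ) 𝓘(ℝ, ℝ) (fun q : PosReals ↦ (q : ℝ)) r = ContinuousLinearMap.id ℝ ℝ :=
  mfderiv_extChartAt_self (I := 𝓘(ℝ, ℝ)) (x := r)

theorem dRadius_apply (p : Cone M) (u : ℝ × E) : dRadius (I := I) p u = u.1 := by
  have h1 : MDifferentiableAt 𝓘(ℝ, ℝ) 𝓘(ℝ, ℝ) (fun q : PosReals ↦ (q : ℝ)) p.1 :=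
    (contMDiff_subtype_val (n := 1)).mdifferentiableAt (by simp)
  have h2 : MDifferentiableAt (coneModel I) 𝓘(ℝ, ℝ) (Prod.fst : Cone M → PosReals) p :=
    mdifferentiableAt_fst
  have h := mfderiv_comp p h1 h2
  rw [mfderiv_fst, mfderiv_posReals_coe] at h
  exact congrArg (fun L : (ℝ × E) →L[ℝ] ℝ ↦ L u) h

theorem coneMetric_apply (g : TensorField02 I M) (p : Cone M) (u v : ℝ × E) :
    coneMetric g p u v = u.1 * v.1 + (p.1 : ℝ) ^ 2 * g p.2 u.2 v.2 := by
  have h : coneMetric g p u v = dRadius (I := I) p u * dRadius (I := I) p v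
      + (p.1 : ℝ) ^ 2 * g p.2 (mfderiv (coneModel I) I (Prod.snd : Cone M → M) p u)
        (mfderiv (coneModel I) I (Prod.snd : Cone M → M) p v) := rfl
  rw [h, mfderiv_snd, dRadius_apply, dRadius_apply]
  rfl

variable [IsManifold I ∞ M] [I.Boundaryless]

theorem mfderiv_extChartAt_cone_symm_apply (p : Cone M) (r : PosReals) {y : E}
    (hy : y ∈ (extChartAt I p.2).target) (u : ℝ × E) :
    mfderiv 𝓘(ℝ, ℝ × E) (coneModel I) (extChartAt (coneModel I) p).symm ((r : ℝ), y) u =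
      (u.1, mfderiv 𝓘(ℝ, E) I (extChartAt I p.2).symm y u.2) := by
  have h1 : HasMFDerivAt 𝓘(ℝ, ℝ × E) 𝓘(ℝ, ℝ)
      ((extChartAt 𝓘(ℝ, ℝ) p.1).symm ∘ (Prod.fst : ℝ × E → ℝ)) ((r : ℝ), y)
      ((ContinuousLinearMap.id ℝ ℝ).comp (ContinuousLinearMap.fst ℝ ℝ E)) :=
    HasMFDerivAt.comp _ (hasMFDerivAt_extChartAt_posReals_symm p.1 r)
      (ContinuousLinearMap.fst ℝ ℝ E).hasMFDerivAt
  have hmd : MDifferentiableAt 𝓘(ℝ, E) I (extChartAt I p.2).symm y :=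
    (contMDiffOn_extChartAt_symm (I := I) (n := ∞) p.2).contMDiffAt
      ((isOpen_extChartAt_target p.2).mem_nhds hy) |>.mdifferentiableAt (by simp)
  have h2 : HasMFDerivAt 𝓘(ℝ, ℝ × E) I
      ((extChartAt I p.2).symm ∘ (Prod.snd : ℝ × E → E)) ((r : ℝ), y)
      ((mfderiv 𝓘(ℝ, E) I (extChartAt I p.2).symm y).comp (ContinuousLinearMap.snd ℝ ℝ E)) :=
    HasMFDerivAt.comp _ hmd.hasMFDerivAt (ContinuousLinearMap.snd ℝ ℝ E).hasMFDerivAt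
  have h3 := (h1.prodMk h2).mfderiv
  have h4 : (fun q : ℝ × E ↦ (((extChartAt 𝓘(ℝ, ℝ) p.1).symm ∘ (Prod.fst : ℝ × E → ℝ)) q,
      ((extChartAt I p.2).symm ∘ (Prod.snd : ℝ × E → E)) q)) =
      (extChartAt (coneModel I) p).symm := by
    rw [extChartAt_prod]
    rfl
  rw [h4] at h3
  exact congrArg (fun L : (ℝ × E) →L[ℝ] (ℝ × E) ↦ L u) h3

theorem components_cone_apply (a : TensorField02 (coneModel I) (Cone M)) (p : Cone M)
    (r : PosReals) {y : E} (hy : y ∈ (extChartAt I p.2).target) (u v : ℝ × E) :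
    components (chartAt (ModelProd ℝ H) p) a ((r : ℝ), y) u v =
      a (r, (extChartAt I p.2).symm y)
        ((u.1, mfderiv 𝓘(ℝ, E) I (extChartAt I p.2).symm y u.2) : ℝ × E)
        ((v.1, mfderiv 𝓘(ℝ, E) I (extChartAt I p.2).symm y v.2) : ℝ × E) := by
  rw [components_chartAt_apply]
  rw [mfderiv_extChartAt_cone_symm_apply p r hy, mfderiv_extChartAt_cone_symm_apply p r hy]
  rw [extChartAt_cone_symm_apply]
  rfl

theorem components_coneMetric (g : TensorField02 I M) (p : Cone M) {q : ℝ × E}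
    (hq : q ∈ (extChartAt (coneModel I) p).target) :
    components (chartAt (ModelProd ℝ H) p) (coneMetric g) q =
      coneForm (components (chartAt H p.2) g) q := by
  rw [extChartAt_cone_target] at hq
  obtain ⟨r, y⟩ := q
  refine ContinuousLinearMap.ext fun u ↦ ContinuousLinearMap.ext fun v ↦ ?_
  refine (components_cone_apply (coneMetric g) p ⟨r, hq.1⟩ hq.2 u v).trans ?_
  rw [coneMetric_apply, coneForm_apply]
  rfl

/-- The Christoffel symbols of the cone over `(M, g)` in a chart of the cone. -/
theorem christoffel_components_coneMetric [FiniteDimensional ℝ E] {g : TensorField02 I M}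
    (hg : IsPseudoRiemannianMetric g) (p : Cone M) {r : ℝ} {y : E} (hr : 0 < r)
    (hy : y ∈ (extChartAt I p.2).target) (u v : ℝ × E) :
    christoffel (components (chartAt (ModelProd ℝ H) p) (coneMetric g)) (r, y) u v =
      (-(r * components (chartAt H p.2) g y u.2 v.2),
        christoffel (components (chartAt H p.2) g) y u.2 v.2
          + r⁻¹ • (u.1 • v.2 + v.1 • u.2)) := by
  have hq : (r, y) ∈ (extChartAt (coneModel I) p).target := by
    rw [extChartAt_cone_target]
    exact ⟨hr, hy⟩
  have hev : components (chartAt (ModelProd ℝ H) p) (coneMetric g) =ᶠ[𝓝 (r, y)]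
      coneForm (components (chartAt H p.2) g) := by
    filter_upwards [(isOpen_extChartAt_target p).mem_nhds hq] with q hq
    exact components_coneMetric g p hq
  have hG := hg.smooth.differentiableAt_components p.2 hy
  have hiG := isInvertible_components hg p.2 hy
  rw [hev.christoffel_eq]
  refine christoffel_coneForm hr.ne' (isInvertible_of_nondegenerate fun u hu ↦ ?_) hiG ?_ hG u v
  · refine Prod.ext ?_ (nondegenerate_components hg.nondegenerate p.2 hy u.2 fun w ↦ ?_)
    · simpa [coneForm_apply] using hu (1, 0)
    · simpa [coneForm_apply, hr.ne'] using hu (0, w)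
  · exact ((hg.smooth.contDiffOn_components p.2).coneForm.contDiffAt
      ((isOpen_univ.prod (isOpen_extChartAt_target p.2)).mem_nhds ⟨mem_univ _, hy⟩)).differentiableAt
      (by simp)

end Cone

variable {E : Type*} [NormedAddCommGroup E] [NormedSpace ℝ E]
  {H : Type*} [TopologicalSpace H] {I : ModelWithCorners ℝ E H}
  {M : Type*} [TopologicalSpace M] [ChartedSpace H M] [IsManifold I ∞ M] [I.Boundaryless]
  {g : TensorField02 I M} {γ : ℝ → M}

section Geodesics

omit [IsManifold I ∞ M] [I.Boundaryless] in
theorem eventually_mem_source (hγ : ContMDiff 𝓘(ℝ, ℝ) I ∞ γ) (t : ℝ) :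
    ∀ᶠ s in 𝓝 t, γ s ∈ (extChartAt I (γ t)).source :=
  hγ.continuous.continuousAt.eventually
    ((isOpen_extChartAt_source (γ t)).mem_nhds (mem_extChartAt_source (γ t)))

omit [I.Boundaryless] in
theorem hasDerivAt_extChartAt_comp (hγ : ContMDiff 𝓘(ℝ, ℝ) I ∞ γ) (t : ℝ) :
    HasDerivAt (extChartAt I (γ t) ∘ γ) (deriv (extChartAt I (γ t) ∘ γ) t) t :=
  ((contDiffAt_extChartAt_comp hγ (γ t) (mem_extChartAt_source (γ t))).differentiableAt
    (by simp)).hasDerivAt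

omit [I.Boundaryless] in
theorem IsGeodesic.hasDerivAt_deriv (hγ : IsGeodesic g γ) (t : ℝ) :
    HasDerivAt (deriv (extChartAt I (γ t) ∘ γ))
      (-christoffel (components (chartAt H (γ t)) g) (extChartAt I (γ t) (γ t))
        (deriv (extChartAt I (γ t) ∘ γ) t) (deriv (extChartAt I (γ t) ∘ γ) t)) t := by
  have hc := contDiffAt_extChartAt_comp hγ.1 (γ t) (mem_extChartAt_source (γ t))
  have hd : ContDiffAt ℝ ∞ (deriv (extChartAt I (γ t) ∘ γ)) t :=
    (hc.fderiv_right (m := ∞) (by simp)).clm_apply contDiffAt_const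
  have h := hγ.2 (chartAt H (γ t)) (IsManifold.chart_mem_maximalAtlas (γ t)) t
    (mem_chart_source H (γ t))
  exact (hd.differentiableAt (by simp)).hasDerivAt.congr_deriv (eq_neg_of_add_eq_zero_left h)

theorem components_deriv (hγ : ContMDiff 𝓘(ℝ, ℝ) I ∞ γ) (B : TensorField02 I M) {x : M} {t : ℝ}
    (ht : γ t ∈ (extChartAt I x).source) :
    components (chartAt H x) B (extChartAt I x (γ t)) (deriv (extChartAt I x ∘ γ) t)
      (deriv (extChartAt I x ∘ γ) t) = B (γ t) (velocity I γ t) (velocity I γ t) :=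
  congrArg (fun p : TangentBundle I M ↦ B p.1 p.2 p.2) (mfderiv_extChartAt_symm_deriv hγ x ht)

/-- The velocity of a geodesic has constant length. -/
theorem IsGeodesic.hasDerivAt_velocity [FiniteDimensional ℝ E] (hg : IsPseudoRiemannianMetric g)
    (hγ : IsGeodesic g γ) (t : ℝ) :
    HasDerivAt (fun s ↦ g (γ s) (velocity I γ s) (velocity I γ s)) 0 t := by
  have hy := mem_extChartAt_target (I := I) (γ t)
  have hd := hg.smooth.differentiableAt_components (γ t) hy
  have hc' := hγ.hasDerivAt_deriv t
  have h := hasDerivAt_apply_apply (G := components (chartAt H (γ t)) g)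
    (c := extChartAt I (γ t) ∘ γ) hd (hasDerivAt_extChartAt_comp hγ.1 t) hc' hc'
  simp only [Function.comp_apply] at h
  rw [covDeriv_self (isInvertible_components hg (γ t) hy) hd
    (.of_forall fun z ↦ hg.symm.components _ z)] at h
  refine (h.congr_of_eventuallyEq ?_).congr_deriv (by simp)
  filter_upwards [eventually_mem_source hγ.1 t] with s hs
  exact (components_deriv hγ.1 g hs).symm

theorem IsGeodesic.velocity_null [FiniteDimensional ℝ E] (hg : IsPseudoRiemannianMetric g)
    (hγ : IsGeodesic g γ) (h : g (γ 0) (velocity I γ 0) (velocity I γ 0) = 0) (t : ℝ) :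
    g (γ t) (velocity I γ t) (velocity I γ t) = 0 := by
  rw [← h]
  exact is_const_of_deriv_eq_zero (fun t ↦ (hγ.hasDerivAt_velocity hg t).differentiableAt)
    (fun t ↦ (hγ.hasDerivAt_velocity hg t).deriv) t 0

end Geodesics

section Parallel

variable {a : TensorField02 (coneModel I) (Cone M)}

omit [I.Boundaryless] in
theorem IsParallel.covDeriv_chartAt (ha : IsParallel (coneMetric g) a) (p : Cone M) {r : ℝ} {y : E}
    (hr : 0 < r) (hy : y ∈ (extChartAt I p.2).target) (u v w : ℝ × E) :
    covDeriv (components (chartAt (ModelProd ℝ H) p) (coneMetric g))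
      (components (chartAt (ModelProd ℝ H) p) a) (r, y) u v w = 0 := by
  refine ha _ (IsManifold.chart_mem_maximalAtlas p) (r, y) ?_ u v w
  have : (r, y) ∈ (extChartAt (coneModel I) p).target := by
    rw [extChartAt_cone_target]
    exact ⟨hr, hy⟩
  exact this

theorem IsSmooth.differentiableAt_components_cone [FiniteDimensional ℝ E] (ha : IsSmooth a)
    (p : Cone M) {r : ℝ} {y : E} (hr : 0 < r) (hy : y ∈ (extChartAt I p.2).target) :
    DifferentiableAt ℝ (components (chartAt (ModelProd ℝ H) p) a) (r, y) :=
  ha.differentiableAt_components p (by rw [extChartAt_cone_target]; exact ⟨hr, hy⟩)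

theorem components_cone_deriv (hγ : ContMDiff 𝓘(ℝ, ℝ) I ∞ γ) (p : Cone M) (r : PosReals)
    {t : ℝ} (ht : γ t ∈ (extChartAt I p.2).source) (k l : ℝ) (ε δ : ℝ) :
    components (chartAt (ModelProd ℝ H) p) a ((r : ℝ), extChartAt I p.2 (γ t))
      (k, ε • deriv (extChartAt I p.2 ∘ γ) t) (l, δ • deriv (extChartAt I p.2 ∘ γ) t) =
    a (r, γ t) ((k, ε • velocity I γ t) : ℝ × E) ((l, δ • velocity I γ t) : ℝ × E) := by
  rw [components_cone_apply a p r ((extChartAt I p.2).map_source ht)]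
  let L : E →L[ℝ] E := mfderiv 𝓘(ℝ, E) I (extChartAt I p.2).symm (extChartAt I p.2 (γ t))
  exact (congrArg₂ (fun v w : E ↦ a (r, (extChartAt I p.2).symm (extChartAt I p.2 (γ t)))
    ((k, v) : ℝ × E) ((l, w) : ℝ × E)) (L.map_smul ε _) (L.map_smul δ _)).trans
    (congrArg (fun q : TangentBundle I M ↦ a (r, q.1) ((k, ε • q.2) : ℝ × E)
      ((l, δ • q.2) : ℝ × E)) (mfderiv_extChartAt_symm_deriv hγ p.2 ht))

/-- Lifting a lightlike geodesic of `M` to height `r` in the cone, the vector fields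
`k ∂_r + ε γ'` along it have covariant derivative `(k / r) γ'`. -/
theorem IsGeodesic.hasDerivAt_cone [FiniteDimensional ℝ E] (hg : IsPseudoRiemannianMetric g)
    (ha : IsSmooth a) (hpar : IsParallel (coneMetric g) a) (hγ : IsGeodesic g γ)
    (hnull : ∀ t, g (γ t) (velocity I γ t) (velocity I γ t) = 0) (r : PosReals)
    (k l ε δ t : ℝ) :
    HasDerivAt (fun s ↦ a (r, γ s) ((k, ε • velocity I γ s) : ℝ × E)
        ((l, δ • velocity I γ s) : ℝ × E))
      (a (r, γ t) ((0, ((r : ℝ)⁻¹ * k) • velocity I γ t) : ℝ × E)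
          ((l, δ • velocity I γ t) : ℝ × E)
        + a (r, γ t) ((k, ε • velocity I γ t) : ℝ × E)
          ((0, ((r : ℝ)⁻¹ * l) • velocity I γ t) : ℝ × E)) t := by
  set p : Cone M := (r, γ t)
  have hy : extChartAt I p.2 (γ t) ∈ (extChartAt I p.2).target := mem_extChartAt_target (γ t)
  have hc := hasDerivAt_extChartAt_comp hγ.1 t
  have hc' := hγ.hasDerivAt_deriv t
  have hX : ∀ k ε : ℝ, HasDerivAt (fun s ↦ (k, ε • deriv (extChartAt I p.2 ∘ γ) s)) _ t :=
    fun k ε ↦ (hasDerivAt_const t k).prodMk (hc'.const_smul ε)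
  have h := hasDerivAt_apply_apply (G := components (chartAt (ModelProd ℝ H) p) (coneMetric g))
    (ha.differentiableAt_components_cone p r.2 hy) ((hasDerivAt_const t (r : ℝ)).prodMk hc)
    (hX k ε) (hX l δ)
  have hn : components (chartAt H p.2) g (extChartAt I p.2 (γ t))
      (deriv (extChartAt I p.2 ∘ γ) t) (deriv (extChartAt I p.2 ∘ γ) t) = 0 :=
    (components_deriv hγ.1 g (mem_extChartAt_source (γ t))).trans (hnull t)
  have hX' : ∀ k ε : ℝ, ((0 : ℝ), ε • -christoffel (components (chartAt H (γ t)) g)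
      (extChartAt I (γ t) (γ t)) (deriv (extChartAt I (γ t) ∘ γ) t)
      (deriv (extChartAt I (γ t) ∘ γ) t)) +
      christoffel (components (chartAt (ModelProd ℝ H) p) (coneMetric g))
        ((r : ℝ), extChartAt I p.2 (γ t)) (0, deriv (extChartAt I p.2 ∘ γ) t)
        (k, ε • deriv (extChartAt I p.2 ∘ γ) t) =
      (0, ((r : ℝ)⁻¹ * k) • deriv (extChartAt I p.2 ∘ γ) t) := by
    intro k ε
    rw [christoffel_components_coneMetric hg p r.2 hy]
    refine Prod.ext ?_ ?_
    · simp only [Prod.fst_add, map_smul, hn, smul_zero, mul_zero, neg_zero, add_zero]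
    · simp only [christoffel_smul_right, Prod.snd_add]
      rw [smul_neg, neg_add_cancel_left, zero_smul, zero_add, mul_smul]
  refine (h.congr_of_eventuallyEq ?_).congr_deriv ?_
  · filter_upwards [eventually_mem_source hγ.1 t] with s hs
    exact (components_cone_deriv hγ.1 p r hs k l ε δ).symm
  · have hs : γ t ∈ (extChartAt I p.2).source := mem_extChartAt_source (γ t)
    have e := hpar.covDeriv_chartAt p r.2 hy
    rw [← components_cone_deriv hγ.1 p r hs, ← components_cone_deriv hγ.1 p r hs, ← hX' k ε,
      ← hX' l δ]
    simp only [Function.comp_apply]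
    rw [e, zero_add]

theorem components_radial (a : TensorField02 (coneModel I) (Cone M)) (p : Cone M) {q : Cone M}
    (hq : q ∈ (extChartAt (coneModel I) p).source) :
    components (chartAt (ModelProd ℝ H) p) a (extChartAt (coneModel I) p q) (1, 0) (1, 0) =
      a q ((1, 0) : ℝ × E) ((1, 0) : ℝ × E) := by
  rw [extChartAt_prod, PartialEquiv.prod_source] at hq
  rw [extChartAt_cone_apply, components_cone_apply a p q.1 ((extChartAt I p.2).map_source hq.2)]
  let L : E →L[ℝ] E := mfderiv 𝓘(ℝ, E) I (extChartAt I p.2).symm (extChartAt I p.2 q.2)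
  refine (congrArg (fun w : E ↦ a (q.1, (extChartAt I p.2).symm (extChartAt I p.2 q.2))
    ((1, w) : ℝ × E) ((1, w) : ℝ × E)) L.map_zero).trans ?_
  rw [(extChartAt I p.2).left_inv hq.2]

theorem continuous_radial [FiniteDimensional ℝ E] (ha : IsSmooth a) :
    Continuous fun p : Cone M ↦ a p ((1, 0) : ℝ × E) ((1, 0) : ℝ × E) := by
  refine continuous_iff_continuousAt.2 fun p ↦ ?_
  have hy := mem_extChartAt_target (I := coneModel I) p
  have hc : ContinuousAt (fun z ↦ components (chartAt (ModelProd ℝ H) p) a z (1, 0) (1, 0))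
      (extChartAt (coneModel I) p p) :=
    (((ha.differentiableAt_components p hy).clm_apply (differentiableAt_const _)).clm_apply
      (differentiableAt_const _)).continuousAt
  refine (hc.comp (continuousAt_extChartAt p)).congr ?_
  filter_upwards [extChartAt_source_mem_nhds (I := coneModel I) p] with q hq
  exact components_radial a p hq

end Parallel

variable {E : Type*} [NormedAddCommGroup E] [NormedSpace ℝ E]
  {H : Type*} [TopologicalSpace H] {I : ModelWithCorners ℝ E H}
  {M : Type*} [TopologicalSpace M] [ChartedSpace H M] [IsManifold I ∞ M] [I.Boundaryless]
  {g : TensorField02 I M}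

section Signature

theorem isOpen_setOf_definite [FiniteDimensional ℝ E] (hg : IsSmooth g) (k : ℝ) :
    IsOpen {x : M | ∀ v : TangentSpace I x, v ≠ 0 → 0 < k * g x v v} := by
  refine isOpen_iff_mem_nhds.2 fun x hx ↦ ?_
  have hd := hg.differentiableAt_components x (mem_extChartAt_target x)
  have h1 : ∀ᶠ y in 𝓝 (extChartAt I x x), ∀ v ∈ Metric.sphere (0 : E) 1,
      0 < k * components (chartAt H x) g y v v := by
    refine (isCompact_sphere (0 : E) 1).eventually_forall_of_forall_eventually fun v hv ↦ ?_
    have hc : ContinuousAt (fun z : E × E ↦ k * components (chartAt H x) g z.1 z.2 z.2)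
        (extChartAt I x x, v) := by
      have h0 : ContinuousAt (fun z : E × E ↦ components (chartAt H x) g z.1)
          (extChartAt I x x, v) := ContinuousAt.comp (g := components (chartAt H x) g)
            (f := fun z : E × E ↦ z.1) hd.continuousAt continuousAt_fst
      exact continuousAt_const.mul ((h0.clm_apply continuousAt_snd).clm_apply continuousAt_snd)
    refine hc.eventually (lt_mem_nhds ?_)
    change 0 < k * components (chartAt H x) g (extChartAt I x x) v v
    rw [components_chartAt_self]
    exact hx v (Metric.ne_of_mem_sphere (α := E) hv one_ne_zero)
  filter_upwards [(continuousAt_extChartAt x).eventually h1,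
    extChartAt_source_mem_nhds (I := I) x] with x' h2 hx' w hw
  have hb := mfderiv_extChartAt_symm_bijective (I := I) x ((extChartAt I x).map_source hx')
  have h3 : ∀ v : E, v ≠ 0 → 0 < k * components (chartAt H x) g (extChartAt I x x') v v := by
    intro v hv
    have hv' : ‖v‖ ≠ 0 := norm_ne_zero_iff.2 hv
    have h4 := h2 (‖v‖⁻¹ • v) (by simp [norm_smul, hv'])
    simp only [map_smul, smul_apply, smul_eq_mul] at h4
    have h5 : 0 < ‖v‖⁻¹ * ‖v‖⁻¹ * (k * components (chartAt H x) g (extChartAt I x x') v v) := by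
      linarith
    exact pos_of_mul_pos_right h5 (by positivity)
  have h4 : ∀ w : TangentSpace I ((extChartAt I x).symm (extChartAt I x x')), w ≠ 0 →
      0 < k * g ((extChartAt I x).symm (extChartAt I x x')) w w := by
    intro w hw
    obtain ⟨v, rfl⟩ := hb.2 w
    exact h3 v fun hv ↦ hw (by rw [hv]; exact map_zero _)
  rw [(extChartAt I x).left_inv hx'] at h4
  exact h4 w hw

theorem isOpen_setOf_takesBothSigns [FiniteDimensional ℝ E] (hg : IsSmooth g) :
    IsOpen {x : M | TakesBothSigns (g x)} := by
  refine isOpen_iff_mem_nhds.2 fun x hx ↦ ?_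
  have hd := hg.differentiableAt_components x (mem_extChartAt_target x)
  have hc : ∀ v : E,
      ContinuousAt (fun x' ↦ components (chartAt H x) g (extChartAt I x x') v v) x := by
    intro v
    have h : ContinuousAt (fun y ↦ components (chartAt H x) g y v v) (extChartAt I x x) :=
      ((hd.clm_apply (differentiableAt_const _)).clm_apply (differentiableAt_const _)).continuousAt
    exact ContinuousAt.comp (f := extChartAt I x) h (continuousAt_extChartAt x)
  obtain ⟨⟨v, hv⟩, w, hw⟩ := hx
  have hv' := components_chartAt_self g x v v
  have hw' := components_chartAt_self g x w w
  filter_upwards [(hc v).eventually (lt_mem_nhds (hv.trans_eq hv'.symm)),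
    (hc w).eventually (gt_mem_nhds (hw'.trans_lt hw)),
    extChartAt_source_mem_nhds (I := I) x] with x' h1 h2 hx'
  have h3 : TakesBothSigns (g ((extChartAt I x).symm (extChartAt I x x'))) := ⟨⟨_, h1⟩, _, h2⟩
  rwa [(extChartAt I x).left_inv hx'] at h3

/-- On a connected manifold an indefinite metric is indefinite at every point. -/
theorem IsIndefinite.takesBothSigns [FiniteDimensional ℝ E] [PreconnectedSpace M]
    (hg : IsPseudoRiemannianMetric g) (hi : IsIndefinite g) (x : M) : TakesBothSigns (g x) := by
  have hE : Nontrivial E := by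
    by_contra h
    rw [not_nontrivial_iff_subsingleton] at h
    exact hi ⟨1, fun x v hv ↦ (hv (Subsingleton.elim (α := E) v 0)).elim⟩
  obtain ⟨e, he⟩ := exists_ne (0 : E)
  have tri := fun x ↦ definite_or_takesBothSigns (hg.symm x) (hg.nondegenerate x)
  have hP := isOpen_setOf_definite hg.smooth 1
  have hN := isOpen_setOf_definite hg.smooth (-1)
  have hD := isOpen_setOf_takesBothSigns hg.smooth
  have hPc : {x : M | ∀ v : TangentSpace I x, v ≠ 0 → 0 < 1 * g x v v}ᶜ =
      {x : M | ∀ v : TangentSpace I x, v ≠ 0 → 0 < -1 * g x v v} ∪ {x | TakesBothSigns (g x)} := by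
    ext x
    simp only [mem_compl_iff, mem_ofPred_eq, mem_union, one_mul, neg_one_mul, neg_pos]
    constructor
    · exact fun h ↦ (tri x).resolve_left h
    · rintro (h | ⟨-, w, hw⟩) h'
      · exact lt_asymm (h e he) (h' e he)
      · exact lt_asymm hw (h' w (by rintro rfl; simp at hw))
  have hNc : {x : M | ∀ v : TangentSpace I x, v ≠ 0 → 0 < -1 * g x v v}ᶜ =
      {x : M | ∀ v : TangentSpace I x, v ≠ 0 → 0 < 1 * g x v v} ∪ {x | TakesBothSigns (g x)} := by
    ext x
    simp only [mem_compl_iff, mem_ofPred_eq, mem_union, one_mul, neg_one_mul, neg_pos]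
    constructor
    · exact fun h ↦ (or_left_comm.1 (tri x)).resolve_left h
    · rintro (h | ⟨⟨w, hw⟩, -⟩) h'
      · exact lt_asymm (h e he) (h' e he)
      · exact lt_asymm hw (h' w (by rintro rfl; simp at hw))
  have hP' := isClopen_iff.1 ⟨⟨hPc ▸ hN.union hD⟩, hP⟩
  have hN' := isClopen_iff.1 ⟨⟨hNc ▸ hP.union hD⟩, hN⟩
  have eP := hP'.resolve_right fun h ↦ hi ⟨1, fun x ↦ h.symm.subset (mem_univ x)⟩
  have eN := hN'.resolve_right fun h ↦ hi ⟨-1, fun x ↦ h.symm.subset (mem_univ x)⟩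
  rw [eP, eN, empty_union, compl_empty] at hPc
  exact hPc.subset (mem_univ x)

end Signature

section Parallel

variable {a : TensorField02 (coneModel I) (Cone M)}

/-- A parallel symmetric tensor field on the cone pairs `∂_r` trivially with lightlike vectors
tangent to `M`: along the lift of a complete lightlike geodesic, `a(∂_r, ∂_r)` is a bounded
quadratic polynomial. -/
theorem radial_lightlike_eq_zero [FiniteDimensional ℝ E] [CompactSpace M]
    (hg : IsPseudoRiemannianMetric g) (hcomplete : IsLightLineComplete g) (ha : IsSmooth a)
    (hsymm : IsSymmetric a) (hpar : IsParallel (coneMetric g) a) (r : PosReals) (x : M)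
    (v : TangentSpace I x) (hv : g x v v = 0) :
    a (r, x) ((1, 0) : ℝ × E) ((0, v) : ℝ × E) = 0 := by
  by_cases hv0 : v = 0
  · rw [hv0]
    exact (a (r, x) ((1, 0) : ℝ × E)).map_zero
  obtain ⟨γ, hγ, h0⟩ := hcomplete x v hv0 hv
  have h0' : (⟨γ 0, velocity I γ 0⟩ : TangentBundle I M) = ⟨x, v⟩ := h0
  have hnull := hγ.velocity_null hg
    ((congrArg (fun p : TangentBundle I M ↦ g p.1 p.2 p.2) h0').trans hv)
  have hder := hγ.hasDerivAt_cone hg ha hpar hnull r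
  have hsm : ∀ (t c : ℝ), ((0, c • velocity I γ t) : ℝ × E) =
      c • ((0, (1 : ℝ) • velocity I γ t) : ℝ × E) := by
    intro t c
    refine Prod.ext (by simp) ?_
    exact congrArg (fun w : E ↦ c • w) (one_smul ℝ (velocity I γ t : E)).symm
  have hl : ∀ (t c : ℝ) (w : ℝ × E), a (r, γ t) ((0, c • velocity I γ t) : ℝ × E) w =
      c * a (r, γ t) ((0, (1 : ℝ) • velocity I γ t) : ℝ × E) w := by
    intro t c w
    rw [hsm]
    exact congrArg (fun L : (ℝ × E) →L[ℝ] ℝ ↦ L w) ((a (r, γ t)).map_smul c _)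
  have hr : ∀ (t c : ℝ) (w : ℝ × E), a (r, γ t) w ((0, c • velocity I γ t) : ℝ × E) =
      c * a (r, γ t) w ((0, (1 : ℝ) • velocity I γ t) : ℝ × E) := by
    intro t c w
    rw [hsm]
    exact (a (r, γ t) w).map_smul c _
  have hr0 : (r : ℝ) ≠ 0 := ne_of_gt r.2
  obtain ⟨C, hC⟩ := (isCompact_range ((continuous_radial ha).comp
    (Continuous.prodMk_right r))).isBounded.exists_norm_le
  have hz : ∀ t, ((1, (0 : ℝ) • velocity I γ t) : ℝ × E) = (1, 0) := fun t ↦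
    Prod.ext rfl (zero_smul ℝ (velocity I γ t : E))
  have key := eq_zero_of_bounded_of_hasDerivAt (C := C) (k := 2 * (r : ℝ)⁻¹) (k' := (r : ℝ)⁻¹)
    (by positivity)
    (fun t ↦ (hder 1 1 0 0 t).congr_deriv (by
      rw [hl, hr]
      linear_combination (r : ℝ)⁻¹ * hsymm (r, γ t) ((0, (1 : ℝ) • velocity I γ t) : ℝ × E)
        ((1, (0 : ℝ) • velocity I γ t) : ℝ × E)))
    (fun t ↦ (hder 1 0 0 1 t).congr_deriv (by
      rw [hl, hr t ((r : ℝ)⁻¹ * 0)]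
      ring))
    (fun t ↦ (hder 0 0 1 1 t).congr_deriv (by
      rw [hl t ((r : ℝ)⁻¹ * 0), hr t ((r : ℝ)⁻¹ * 0)]
      ring))
    (fun t ↦ by
      rw [hz]
      exact hC _ ⟨γ t, rfl⟩)
  rw [hz] at key
  have e := congrArg (fun p : TangentBundle I M ↦ a (r, p.1) ((1, 0) : ℝ × E)
    ((0, (1 : ℝ) • p.2) : ℝ × E)) h0'
  have e' : ((0, (1 : ℝ) • v) : ℝ × E) = (0, v) := Prod.ext rfl (one_smul ℝ (v : E))
  exact (congrArg (a (r, x) ((1, 0) : ℝ × E)) e'.symm).trans (e.symm.trans key)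

theorem radial_tangential_eq_zero [FiniteDimensional ℝ E] [CompactSpace M] [PreconnectedSpace M]
    (hg : IsPseudoRiemannianMetric g) (hi : IsIndefinite g) (hcomplete : IsLightLineComplete g)
    (ha : IsSmooth a) (hsymm : IsSymmetric a) (hpar : IsParallel (coneMetric g) a) (p : Cone M)
    (u : E) : a p ((1, 0) : ℝ × E) ((0, u) : ℝ × E) = 0 := by
  let l : E →L[ℝ] ℝ := (show (ℝ × E) →L[ℝ] ℝ from a p ((1, 0) : ℝ × E)).comp
    (ContinuousLinearMap.inr ℝ ℝ E)
  exact (hi.takesBothSigns hg p.2).eq_zero_of_null (hg.symm p.2) (l := (l : E →ₗ[ℝ] ℝ))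
    (fun v hv ↦ radial_lightlike_eq_zero hg hcomplete ha hsymm hpar p.1 p.2 v hv) u

theorem components_radial_tangential
    (hrad : ∀ (p : Cone M) (u : E), a p ((1, 0) : ℝ × E) ((0, u) : ℝ × E) = 0) (p : Cone M)
    {r : ℝ} {y : E} (hr : 0 < r) (hy : y ∈ (extChartAt I p.2).target) (u : E) :
    components (chartAt (ModelProd ℝ H) p) a (r, y) (1, 0) (0, u) = 0 := by
  rw [components_cone_apply a p ⟨r, hr⟩ hy]
  let L : E →L[ℝ] E := mfderiv 𝓘(ℝ, E) I (extChartAt I p.2).symm y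
  exact (congrArg (fun w : E ↦ a (⟨r, hr⟩, (extChartAt I p.2).symm y)
    ((1, w) : ℝ × E) ((0, L u) : ℝ × E)) L.map_zero).trans (hrad _ _)

section Radial

variable [FiniteDimensional ℝ E] (hg : IsPseudoRiemannianMetric g) (ha : IsSmooth a)
  (hsymm : IsSymmetric a) (hpar : IsParallel (coneMetric g) a)
  (hrad : ∀ (p : Cone M) (u : E), a p ((1, 0) : ℝ × E) ((0, u) : ℝ × E) = 0)

include hg ha hpar hrad in
theorem tangential_eq (p : Cone M) (u w : E) :
    a p ((0, u) : ℝ × E) ((0, w) : ℝ × E) =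
      a p ((1, 0) : ℝ × E) ((1, 0) : ℝ × E) * ((p.1 : ℝ) ^ 2 * g p.2 u w) := by
  set A := components (chartAt (ModelProd ℝ H) p) a with hA
  set y := extChartAt I p.2 p.2 with hydef
  have hr0 : (p.1 : ℝ) ≠ 0 := ne_of_gt p.1.2
  have hy : y ∈ (extChartAt I p.2).target := mem_extChartAt_target p.2
  have hd : DifferentiableAt ℝ A ((p.1 : ℝ), y) := ha.differentiableAt_components_cone p p.1.2 hy
  have hq : ((p.1 : ℝ), y) ∈ (extChartAt (coneModel I) p).target := by
    rw [extChartAt_cone_target]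
    exact ⟨p.1.2, hy⟩
  have hev : (fun z ↦ A z (1, 0) (0, w)) =ᶠ[𝓝 ((p.1 : ℝ), y)] fun _ ↦ 0 := by
    filter_upwards [(isOpen_extChartAt_target p).mem_nhds hq] with z hz
    rw [extChartAt_cone_target] at hz
    exact components_radial_tangential hrad p hz.1 hz.2 w
  have hcov := hpar.covDeriv_chartAt p p.1.2 hy (0, u) (1, 0) (0, w)
  have hΓ₁ : christoffel (components (chartAt (ModelProd ℝ H) p) (coneMetric g)) ((p.1 : ℝ), y)
      (0, u) (1, 0) = (p.1 : ℝ)⁻¹ • (0, u) := by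
    rw [christoffel_components_coneMetric hg p p.1.2 hy]
    refine Prod.ext (by simp) ?_
    simp [christoffel_zero_right]
  rw [covDeriv, ← hA, ← fderiv_apply_apply hd, hev.fderiv_eq, hΓ₁,
    christoffel_components_coneMetric hg p p.1.2 hy, apply_prod_prod _ (1, 0),
    components_radial_tangential hrad p p.1.2 hy] at hcov
  simp only [fderiv_fun_const, Pi.zero_apply, zero_apply, map_smul, Prod.mk_zero_zero, map_zero,
    mul_zero, add_zero, smul_apply, smul_eq_mul] at hcov
  have hself : ∀ u v : ℝ × E, A ((p.1 : ℝ), y) u v = a p u v := by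
    intro u v
    rw [hydef, ← extChartAt_cone_apply p p]
    exact components_chartAt_self a p u v
  have hG : components (chartAt H p.2) g y u w = g p.2 u w := components_chartAt_self g p.2 u w
  rw [hself, hself, hG] at hcov
  field_simp at hcov
  linear_combination -hcov

include hg ha hpar hrad hsymm in
theorem fderiv_components_radial (p : Cone M) {r : ℝ} {y : E} (hr : 0 < r)
    (hy : y ∈ (extChartAt I p.2).target) :
    fderiv ℝ (fun z ↦ components (chartAt (ModelProd ℝ H) p) a z (1, 0) (1, 0)) (r, y) = 0 := by
  refine ContinuousLinearMap.ext fun u ↦ ?_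
  have hcov := hpar.covDeriv_chartAt p hr hy u (1, 0) (1, 0)
  have hΓ : christoffel (components (chartAt (ModelProd ℝ H) p) (coneMetric g)) (r, y) u (1, 0) =
      (0, r⁻¹ • u.2) := by
    rw [christoffel_components_coneMetric hg p hr hy]
    refine Prod.ext (by simp) ?_
    simp [christoffel_zero_right]
  rw [fderiv_apply_apply (ha.differentiableAt_components_cone p hr hy)]
  rw [covDeriv, hΓ, components_radial_tangential hrad p hr hy,
    hsymm.components _ _ (0, r⁻¹ • u.2), components_radial_tangential hrad p hr hy] at hcov
  simpa using hcov

include hg ha hpar hrad hsymm in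
theorem isLocallyConstant_radial :
    IsLocallyConstant fun p : Cone M ↦ a p ((1, 0) : ℝ × E) ((1, 0) : ℝ × E) := by
  rw [IsLocallyConstant.iff_eventually_eq]
  intro p
  have hq := mem_extChartAt_target (I := coneModel I) p
  have hopen := isOpen_extChartAt_target (I := coneModel I) p
  obtain ⟨ε, hε, hball⟩ := Metric.isOpen_iff.1 hopen _ hq
  filter_upwards [(continuousAt_extChartAt (I := coneModel I) p).eventually
    (Metric.ball_mem_nhds _ hε), extChartAt_source_mem_nhds (I := coneModel I) p] with q hqb hqs
  rw [← components_radial a p hqs, ← components_radial a p (mem_extChartAt_source p)]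
  refine (Metric.isOpen_ball (x := extChartAt (coneModel I) p p) (ε := ε)).is_const_of_fderiv_eq_zero
    (𝕜 := ℝ) (E := ℝ × E) (G := ℝ)
    (f := fun z ↦ components (chartAt (ModelProd ℝ H) p) a z (1, 0) (1, 0))
    (convex_ball _ _).isPreconnected (fun z hz ↦ ?_) (fun z hz ↦ ?_) hqb (Metric.mem_ball_self hε)
  · exact (((ha.differentiableAt_components p (hball hz)).clm_apply
      (differentiableAt_const _)).clm_apply (differentiableAt_const _)).differentiableWithinAt
  · have hz' := hball hz
    rw [extChartAt_cone_target] at hz'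
    exact fderiv_components_radial hg ha hsymm hpar hrad p hz'.1 hz'.2

include hg ha hpar hrad hsymm in
theorem eq_smul_coneMetric (p : Cone M) :
    a p = a p ((1, 0) : ℝ × E) ((1, 0) : ℝ × E) • coneMetric g p := by
  refine ContinuousLinearMap.ext fun u ↦ ContinuousLinearMap.ext fun v ↦ ?_
  have h1 := coneMetric_apply g p u v
  have h2 := apply_prod_prod (E := E) (a p) u v
  have h3 := tangential_eq hg ha hpar hrad p u.2 v.2
  have h4 := hrad p u.2
  have h5 := hrad p v.2
  have h6 := hsymm p ((0, u.2) : ℝ × E) ((1, 0) : ℝ × E)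
  have h7 : (a p ((1, 0) : ℝ × E) ((1, 0) : ℝ × E) • coneMetric g p) u v =
    a p ((1, 0) : ℝ × E) ((1, 0) : ℝ × E) * coneMetric g p u v := rfl
  rw [h7, h1]
  refine h2.trans ?_
  linear_combination h3 + u.1 * h5 + v.1 * h6 + v.1 * h4

end Radial

end Parallel

end PseudoRiemannian

end

theorem corollary3 (n : ℕ) {M : Type*} [TopologicalSpace M] [T2Space M] [CompactSpace M]
    [ConnectedSpace M] [ChartedSpace (EuclideanSpace ℝ (Fin n)) M] [IsManifold (𝓡 n) ∞ M]
    (g : PseudoRiemannian.TensorField02 (𝓡 n) M)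
    (hg : PseudoRiemannian.IsPseudoRiemannianMetric g)
    (hind : PseudoRiemannian.IsIndefinite g)
    (hcomplete : PseudoRiemannian.IsLightLineComplete g)
    (a : PseudoRiemannian.TensorField02
      (PseudoRiemannian.coneModel (𝓡 n)) (PseudoRiemannian.Cone M))
    (ha_smooth : PseudoRiemannian.IsSmooth a)
    (ha_symm : PseudoRiemannian.IsSymmetric a)
    (ha_parallel : PseudoRiemannian.IsParallel (PseudoRiemannian.coneMetric g) a) :
    ∃ c : ℝ, ∀ p : PseudoRiemannian.Cone M, a p = c • PseudoRiemannian.coneMetric g p := by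
  have hrad := PseudoRiemannian.radial_tangential_eq_zero hg hind hcomplete ha_smooth ha_symm
    ha_parallel
  have : PreconnectedSpace PseudoRiemannian.PosReals :=
    isPreconnected_iff_preconnectedSpace.1 isPreconnected_Ioi
  obtain ⟨x⟩ := (inferInstance : Nonempty M)
  refine ⟨a (⟨1, zero_lt_one' ℝ⟩, x) ((1, 0) : ℝ × EuclideanSpace ℝ (Fin n))
    ((1, 0) : ℝ × EuclideanSpace ℝ (Fin n)), fun p ↦
    (PseudoRiemannian.eq_smul_coneMetric hg ha_smooth ha_symm ha_parallel hrad p).trans ?_⟩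
  exact congrArg (fun c : ℝ ↦ c • PseudoRiemannian.coneMetric g p)
    ((PseudoRiemannian.isLocallyConstant_radial hg ha_smooth ha_symm ha_parallel
      hrad).apply_eq_of_preconnectedSpace p (⟨1, zero_lt_one' ℝ⟩, x))
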